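/- Let $d\ge 2$ and let $\Lambda=\prod_{i=1}^d (a_i,b_i]\subset\mathbb{R}^d$, $a_i<b_i$, be a rectangular box with periodic boundary conditions: differences $x-y$ of points of $\Lambda$ are understood modulo $\Lambda$, so that $|x-y|=\min_{m\in\mathbb{Z}^d}\|x-y+(m_i(b_i-a_i))_{i}\|$ with the Euclidean norm $\|\cdot\|$. Let $\mathcal{X}_\Lambda$ be the set of all finite subsets of $\Lambda$. For $X\in\mathcal{X}_\Lambda$ let $E_X=\{\{x,y\}\subset X: x\ne y,\ |x-y|\le 1\}$; the connected components of the graph $(X,E_X)$ are called the clusters of $X$, and $k(X)$ is their number. Let $\kappa(\Lambda)=\max\{k(X): X\in\mathcal{X}_\Lambda\}$; this maximum exists. Let $L_\Lambda$ be the Lebesgue--Poisson measure on $\mathcal{X}_\Lambda$, \[ L_\Lambda(A)=\sum_{n\ge 0}\frac1{n!}\int_{\Lambda^n}1_A(\{x_1,\dots,x_n\})\,dx_1\cdots dx_n , \] and, for $q>0$ and $z>0$, let $\chi_{\Lambda,z,0}$ be the Widom--Rowlinson (temperature $T=0$) random-cluster measure, i.e. the probability measure \[ \chi_{\Lambda,z,0}(dX)=Z_{\Lambda,z,0}^{-1}\,z^{\#X}q^{k(X)}\,L_\Lambda(dX),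 \] where $Z_{\Lambda,z,0}\in(0,\infty)$ is the normalizing constant. For $X\in\mathcal{X}_\Lambda$ and a cluster $C$ of $X$ let $\Delta_C(X)=\{x\in\Lambda: |y-x|>1 \text{ for all } y\in X\setminus C\}$, and define the dissociation probability of $C$ by \[ \delta_C(X)=|\Delta_C(X)|^{-\#C}\int_{\Delta_C(X)^{\#C}}1_{\{k(\{x_1,\dots,x_{\#C}\})\ge 2\}}\,dx_1\cdots dx_{\#C}, \] where $|\cdot|$ of a set is its Lebesgue measure; this is the probability that $\#C$ points thrown independently and uniformly into $\Delta_C(X)$ form at least two clusters. Then for all $q>0$, $\delta>0$ and $z>0$, \[ \chi_{\Lambda,z,0}\big(X\in\mathcal{X}_\Lambda:\ \exists\text{ a cluster } C\subset X \text{ with } \delta_C(X)\ge\delta\big)\ \le\ \frac{2^{\kappa(\Lambda)}}{\delta q}. \] -/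

import Mathlib

open MeasureTheory

noncomputable section

namespace ContinuumPotts

/-- Points of `ℝ^d`, with the Euclidean norm and Lebesgue measure. -/
abbrev Point (d : ℕ) : Type := EuclideanSpace ℝ (Fin d)

/-- Configurations: finite subsets of `ℝ^d`; the configurations in a box are those contained in
the box. This is a one-field structure, and not `Finset (Point d)` itself, because the general
σ-algebra on `Finset α` (generated by the maps `a ∈ ·`) does not see the Borel structure
of `ℝ^d`. -/
@[ext]
structure Config (d : ℕ) : Type where
  /-- The set of occupied positions. -/
  points : Finset (Point d)

/-- The configuration `{x₁, …, xₙ}`. -/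
def toConfig {d : ℕ} (n : ℕ) (x : Fin n → Point d) : Config d :=
  open Classical in ⟨Finset.univ.image x⟩

/-- A set `A` of finite configurations is measurable if, for every `n`, the set of all
`(x₁, …, xₙ)` with `{x₁, …, xₙ} ∈ A` is a Borel set. -/
instance configMeasurableSpace (d : ℕ) : MeasurableSpace (Config d) :=
  ⨅ n : ℕ, MeasurableSpace.map (toConfig (d := d) n) inferInstance

theorem measurable_toConfig {d : ℕ} (n : ℕ) : Measurable (toConfig (d := d) n) :=
  measurable_iff_le_map.2 fun _ hs => (MeasurableSpace.measurableSet_iInf.1 hs) n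

theorem measurableSet_config_iff {d : ℕ} (A : Set (Config d)) :
    MeasurableSet A ↔ ∀ n, MeasurableSet (toConfig n ⁻¹' A) :=
  MeasurableSpace.measurableSet_iInf

/-- The rectangular box `∏ᵢ (lowerᵢ, upperᵢ]` as a subset of `ℝ^d`. -/
def region {d : ℕ} (Λ : BoxIntegral.Box (Fin d)) : Set (Point d) :=
  {x | WithLp.ofLp x ∈ Λ}

/-- `|x - y| ≤ 1` with the difference understood modulo the box `Λ` (periodic boundary
conditions): some representative of `x - y` modulo the side lengths has norm at most `1`. -/
def Near {d : ℕ} (Λ : BoxIntegral.Box (Fin d)) (x y : Point d) : Prop :=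
  ∃ m : Fin d → ℤ,
    ‖x - y + WithLp.toLp 2 (fun i => (m i : ℝ) * (Λ.upper i - Λ.lower i))‖ ≤ 1

/-- The graph `(X, E_X)`: distinct points of `X` are joined iff `|x - y| ≤ 1` modulo `Λ`. -/
def graph {d : ℕ} (Λ : BoxIntegral.Box (Fin d)) (X : Finset (Point d)) : SimpleGraph X :=
  SimpleGraph.fromRel fun x y => Near Λ x.1 y.1

/-- `k(X)`, the number of clusters (connected components) of `(X, E_X)`. -/
def numClusters {d : ℕ} (Λ : BoxIntegral.Box (Fin d)) (X : Finset (Point d)) : ℕ :=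
  Nat.card (graph Λ X).ConnectedComponent

/-- `C` is a cluster of `X`, i.e. the vertex set of a connected component of `(X, E_X)`. -/
def IsCluster {d : ℕ} (Λ : BoxIntegral.Box (Fin d)) (X C : Finset (Point d)) : Prop :=
  ∃ c : (graph Λ X).ConnectedComponent, (C : Set (Point d)) = Subtype.val '' c.supp

/-- `κ(Λ)`, the maximal number of clusters of a configuration in `Λ`. -/
def maxClusters {d : ℕ} (Λ : BoxIntegral.Box (Fin d)) : ℕ :=
  sSup {k | ∃ X : Finset (Point d), (X : Set (Point d)) ⊆ region Λ ∧ numClusters Λ X = k}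

/-- The Lebesgue–Poisson measure
`L_Λ(A) = ∑ₙ 1/n! ∫_{Λⁿ} 1_A({x₁, …, xₙ}) dx₁ ⋯ dxₙ`. -/
def lebesguePoisson {d : ℕ} (Λ : BoxIntegral.Box (Fin d)) : Measure (Config d) :=
  Measure.sum fun n : ℕ =>
    (Nat.factorial n : ENNReal)⁻¹ •
      (Measure.pi fun _ : Fin n => (volume : Measure (Point d)).restrict (region Λ)).map
        (toConfig n)

/-- The weight `z^{#X} q^{k(X)}`. -/
def weight {d : ℕ} (Λ : BoxIntegral.Box (Fin d)) (q z : ℝ) (X : Config d) : ENNReal :=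
  ENNReal.ofReal (z ^ X.points.card * q ^ numClusters Λ X.points)

/-- The normalizing constant `Z_{Λ,z,0}`. -/
def partitionFunction {d : ℕ} (Λ : BoxIntegral.Box (Fin d)) (q z : ℝ) : ENNReal :=
  ∫⁻ X, weight Λ q z X ∂(lebesguePoisson Λ)

/-- The random-cluster measure `χ_{Λ,z,0}` of the Widom–Rowlinson model. At `T = 0` the
edge set of a configuration `X` is deterministic, so it is a measure on configurations. -/
def randomCluster {d : ℕ} (Λ : BoxIntegral.Box (Fin d)) (q z : ℝ) : Measure (Config d) :=
  (partitionFunction Λ q z)⁻¹ • (lebesguePoisson Λ).withDensity (weight Λ q z)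

/-- The part `𝒰(Y)` of `Λ` in which any point is connected to `Y`. -/
def covered {d : ℕ} (Λ : BoxIntegral.Box (Fin d)) (Y : Set (Point d)) : Set (Point d) :=
  {x | x ∈ region Λ ∧ ∃ y ∈ Y, Near Λ y x}

/-- The available free space `Δ_C(X) = Λ \ 𝒰(X \ C)` of `C`. -/
def freeSpace {d : ℕ} (Λ : BoxIntegral.Box (Fin d)) (X C : Finset (Point d)) : Set (Point d) :=
  region Λ \ covered Λ ((X : Set (Point d)) \ (C : Set (Point d)))

/-- `L_{Δ|N}`, the distribution of `N` particles thrown independently and uniformly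
into `Δ`. -/
def uniformConfig {d : ℕ} (Δ : Set (Point d)) (N : ℕ) : Measure (Config d) :=
  ((volume Δ) ^ N)⁻¹ •
    (Measure.pi fun _ : Fin N => (volume : Measure (Point d)).restrict Δ).map (toConfig N)

/-- The dissociation probability `δ_C(X) = L_{Δ_C(X)|#C}(ξ : k(ξ) ≥ 2)`. -/
def dissociationProb {d : ℕ} (Λ : BoxIntegral.Box (Fin d)) (X C : Finset (Point d)) : ℝ :=
  (uniformConfig (freeSpace Λ X C) C.card).real {ξ | 2 ≤ numClusters Λ ξ.points}

end ContinuumPotts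

end

noncomputable section

namespace ContinuumPotts

/-! The bound comes from resampling one cluster inside its free space. Label the points by `Fin n`,
fix a set `S` of labels, and freeze the configuration `Y` carried by the other labels. If the points
of `S` form one cluster isolated from `Y`, the weight is `q^(k(Y)+1)`, and the dissociation
probability depends only on `Y` and `#S`. Weighted by that probability, the volume of such cluster
positions is at most the volume of isolated positions with at least two clusters, where for `q ≥ 1`
the weight is at least `q^(k(Y)+2)`. So each `S` gains a factor `q⁻¹`
(`lintegral_clusterWeight_le`).

Now sum over `S`. A configuration with an easily dissociating cluster is counted by some `S`, which
yields the factor `δ` on the left (`mul_pow_le_sum_clusterWeight`). On the right every `S` isolated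
from its complement contributes the full weight `q^k`. Such an `S` is a union of clusters, so there
are at most `2^k ≤ 2^κ` of them (`card_separated_le`, `sum_isolatedWeight_le`). Summing over `n` and
dividing by the partition function gives the claim for `q ≥ 1`; for `q < 1` it is trivial. -/

variable {d : ℕ} (Λ : BoxIntegral.Box (Fin d))

/-! ### Connected components as quotients -/

/-- The components of the graph generated by a relation are its generated classes. -/
def componentEquivQuot {α : Type*} (r : α → α → Prop) :
    (SimpleGraph.fromRel r).ConnectedComponent ≃ Quot r where
  toFun := Quot.lift (Quot.mk r) fun a b h => by
    rw [SimpleGraph.reachable_iff_reflTransGen] at h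
    induction h with
    | refl => rfl
    | tail _ hab ih =>
      rw [ih]
      rcases ((SimpleGraph.fromRel_adj _ _ _).1 hab).2 with h | h
      · exact Quot.sound h
      · exact (Quot.sound h).symm
  invFun := Quot.lift (SimpleGraph.fromRel r).connectedComponentMk fun a b h => by
    by_cases hab : a = b
    · rw [hab]
    · exact SimpleGraph.ConnectedComponent.sound
        (SimpleGraph.Adj.reachable ((SimpleGraph.fromRel_adj _ _ _).2 ⟨hab, Or.inl h⟩))
  left_inv := by rintro ⟨a⟩; rfl
  right_inv := by rintro ⟨a⟩; rfl

/-- Pulling a reflexive relation back along a surjection does not change its classes. -/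
def quotPullbackEquiv {α β : Type*} (r : α → α → Prop) (hr : ∀ a, r a a) (f : β → α)
    (hf : Function.Surjective f) : Quot (fun i j => r (f i) (f j)) ≃ Quot r where
  toFun := Quot.lift (fun i => Quot.mk r (f i)) fun _ _ h => Quot.sound h
  invFun := Quot.lift (fun a => Quot.mk _ (Function.surjInv hf a)) fun a b h =>
    Quot.sound (by simpa only [Function.surjInv_eq hf] using h)
  left_inv := by
    rintro ⟨i⟩
    refine Quot.sound ?_
    simpa only [Function.surjInv_eq hf] using hr (f i)
  right_inv := by
    rintro ⟨a⟩
    exact congrArg (Quot.mk r) (Function.surjInv_eq hf a)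

/-! ### Clusters -/

theorem Near.symm {Λ : BoxIntegral.Box (Fin d)} {x y : Point d} (h : Near Λ x y) :
    Near Λ y x := by
  obtain ⟨m, hm⟩ := h
  refine ⟨-m, ?_⟩
  have : y - x + WithLp.toLp 2 (fun i => (((-m) i : ℤ) : ℝ) * (Λ.upper i - Λ.lower i)) =
      -(x - y + WithLp.toLp 2 (fun i => (m i : ℝ) * (Λ.upper i - Λ.lower i))) := by
    ext i
    simp
    ring
  rw [this, norm_neg]
  exact hm

theorem near_of_dist_le {x y : Point d} (h : dist x y ≤ 1) : Near Λ x y := by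
  refine ⟨0, ?_⟩
  have : WithLp.toLp 2 (fun i => (((0 : Fin d → ℤ) i : ℤ) : ℝ) * (Λ.upper i - Λ.lower i))
      = (0 : Point d) := by
    ext i
    simp
  rw [this, add_zero, ← dist_eq_norm]
  exact h

theorem near_self (x : Point d) : Near Λ x x := near_of_dist_le Λ (by simp)

theorem numClusters_eq_card_quot (X : Finset (Point d)) :
    numClusters Λ X = Nat.card (Quot fun a b : X => Near Λ a.1 b.1) :=
  Nat.card_congr (componentEquivQuot _)

/-- The set of entries of a finite family of points. -/
def tupleSet {ι : Type*} [Fintype ι] (x : ι → Point d) : Finset (Point d) :=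
  open Classical in Finset.univ.image x

@[simp]
theorem mem_tupleSet {ι : Type*} [Fintype ι] {x : ι → Point d} {a : Point d} :
    a ∈ tupleSet x ↔ ∃ i, x i = a := by
  simp [tupleSet]

theorem toConfig_points (n : ℕ) (x : Fin n → Point d) : (toConfig n x).points = tupleSet x := rfl

theorem card_tupleSet {ι : Type*} [Fintype ι] {x : ι → Point d} (hx : Function.Injective x) :
    (tupleSet x).card = Fintype.card ι := by
  classical
  rw [tupleSet, Finset.card_image_of_injective _ hx, Finset.card_univ]

theorem tupleSet_comp_equiv {ι κ : Type*} [Fintype ι] [Fintype κ] (e : κ ≃ ι) (x : ι → Point d) :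
    tupleSet (fun k => x (e k)) = tupleSet x := by
  ext a
  simp only [mem_tupleSet]
  exact e.exists_congr_left.trans (by simp)

/-- Repeated entries do no harm because `Near` is reflexive. The count now lives on the fixed index
type, which makes it amenable to measurability and to splitting by labels. -/
theorem numClusters_tupleSet {ι : Type*} [Fintype ι] (x : ι → Point d) :
    numClusters Λ (tupleSet x) = Nat.card (Quot fun i j => Near Λ (x i) (x j)) := by
  rw [numClusters_eq_card_quot]
  refine (Nat.card_congr (quotPullbackEquiv (fun a b : tupleSet x => Near Λ a.1 b.1)
    (fun a => near_self Λ a.1) (fun i => ⟨x i, mem_tupleSet.2 ⟨i, rfl⟩⟩) ?_)).symm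
  rintro ⟨a, ha⟩
  obtain ⟨i, rfl⟩ := mem_tupleSet.1 ha
  exact ⟨i, rfl⟩

theorem numClusters_empty : numClusters Λ ∅ = 0 := by
  rw [numClusters_eq_card_quot]
  have : IsEmpty (Quot fun a b : (∅ : Finset (Point d)) => Near Λ a.1 b.1) :=
    ⟨fun c => by obtain ⟨⟨a, ha⟩⟩ := c; simp at ha⟩
  exact Nat.card_of_isEmpty

/-- The number of clusters is additive over separated parts of a family. -/
theorem numClusters_tupleSet_add {ι : Type*} [Fintype ι] [DecidableEq ι] (x : ι → Point d) (S : Finset ι)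
    (hS : ∀ i ∈ S, ∀ j ∉ S, ¬ Near Λ (x j) (x i)) :
    numClusters Λ (tupleSet fun i : {i // i ∈ S} => x i) +
      numClusters Λ (tupleSet fun i : {i // i ∉ S} => x i) = numClusters Λ (tupleSet x) := by
  classical
  rw [numClusters_tupleSet, numClusters_tupleSet, numClusters_tupleSet, ← Nat.card_sum]
  have hinl : ∀ i j, Near Λ (x i) (x j) → i ∈ S → j ∈ S := fun i j h hi => by
    by_contra hj
    exact hS i hi j hj h.symm
  refine (Nat.card_congr ⟨Quot.lift (fun i => if h : i ∈ S then Sum.inl (Quot.mk _ ⟨i, h⟩)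
    else Sum.inr (Quot.mk _ ⟨i, h⟩)) ?_, Sum.elim (Quot.lift (fun i => Quot.mk _ i.1) ?_)
      (Quot.lift (fun i => Quot.mk _ i.1) ?_), ?_, ?_⟩).symm
  · intro i j h
    by_cases hi : i ∈ S
    · have hj := hinl i j h hi
      simp only [hi, hj, dif_pos]
      exact congrArg _ (Quot.sound h)
    · have hj : j ∉ S := fun hj => hi (hinl j i h.symm hj)
      simp only [hi, hj, dif_neg, not_false_iff]
      exact congrArg _ (Quot.sound h)
  · exact fun i j h => Quot.sound h
  · exact fun i j h => Quot.sound h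
  · rintro ⟨i⟩
    by_cases hi : i ∈ S
    · simp [hi]
    · simp [hi]
  · rintro (⟨⟨i, hi⟩⟩ | ⟨⟨i, hi⟩⟩)
    · simp [hi]
    · simp [hi]

/-- A family with `k` clusters has at most `2 ^ k` separated parts. -/
theorem card_separated_le {ι : Type*} [Fintype ι] (x : ι → Point d) :
    Nat.card {S : Finset ι // ∀ i ∈ S, ∀ j ∉ S, ¬ Near Λ (x j) (x i)} ≤
      2 ^ numClusters Λ (tupleSet x) := by
  have hp : Nat.card ((Quot fun i j => Near Λ (x i) (x j)) → Prop) =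
      2 ^ numClusters Λ (tupleSet x) := by
    rw [numClusters_tupleSet, Nat.card_fun]
    congr 1
    simp
  rw [← hp]
  -- A separated part is a union of classes, so membership in it descends to a predicate on the
  -- quotient.
  refine Nat.card_le_card_of_injective (fun S => Quot.lift (fun i => i ∈ S.1) ?_) ?_
  · intro i j h
    refine propext ⟨fun hi => ?_, fun hj => ?_⟩
    · by_contra hj
      exact S.2 i hi j hj h.symm
    · by_contra hi
      exact S.2 j hj i hi h
  · intro S T h
    ext i
    exact iff_of_eq (congrFun h (Quot.mk _ i))

theorem IsCluster.subset {X C : Finset (Point d)} (h : IsCluster Λ X C) : C ⊆ X := by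
  obtain ⟨c, hc⟩ := h
  intro a ha
  have : a ∈ (C : Set (Point d)) := ha
  rw [hc] at this
  obtain ⟨b, -, rfl⟩ := this
  exact b.2

theorem IsCluster.not_near {X C : Finset (Point d)} (h : IsCluster Λ X C) {a b : Point d}
    (ha : a ∈ C) (hbX : b ∈ X) (hb : b ∉ C) : ¬ Near Λ b a := by
  obtain ⟨c, hc⟩ := h
  intro hn
  have ha' : a ∈ (C : Set (Point d)) := ha
  have hb' : b ∉ (C : Set (Point d)) := hb
  rw [hc] at ha' hb'
  obtain ⟨a, hac, rfl⟩ := ha'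
  refine hb' ⟨⟨b, hbX⟩, ?_, rfl⟩
  refine (SimpleGraph.ConnectedComponent.mem_supp_congr_adj c ?_).1 hac
  refine (SimpleGraph.fromRel_adj _ _ _).2 ⟨?_, Or.inr hn⟩
  rintro rfl
  exact hb ha

/-- A path in `X` starting in `C` never leaves `C`, so it also connects its endpoints within the
graph of `C` alone. -/
theorem IsCluster.numClusters_eq_one {X C : Finset (Point d)} (h : IsCluster Λ X C) :
    numClusters Λ C = 1 := by
  obtain ⟨c, hc⟩ := h
  have hmem : ∀ a : X, a.1 ∈ C ↔ a ∈ c.supp := fun a => by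
    rw [← Finset.mem_coe, hc, Subtype.val_injective.mem_set_image]
  rw [numClusters_eq_card_quot, Nat.card_eq_one_iff_unique]
  obtain ⟨a₀, rfl⟩ := c.exists_rep
  have h₀ : a₀.1 ∈ C := (hmem a₀).2 rfl
  have key : ∀ b : X, (graph Λ X).Reachable a₀ b → ∀ hb : b.1 ∈ C,
      Quot.mk (fun a b : C => Near Λ a.1 b.1) ⟨a₀.1, h₀⟩ = Quot.mk _ ⟨b.1, hb⟩ := by
    intro b hb
    rw [SimpleGraph.reachable_iff_reflTransGen] at hb
    induction hb with
    | refl => exact fun _ => rfl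
    | @tail b b' hb hbb' ih =>
      intro hb'
      have hbC : b.1 ∈ C := (hmem b).2 (((hmem b').1 hb') ▸
        SimpleGraph.ConnectedComponent.sound (SimpleGraph.Adj.reachable hbb'))
      rw [ih hbC]
      rcases ((SimpleGraph.fromRel_adj _ _ _).1 hbb').2 with h | h
      · exact Quot.sound h
      · exact (Quot.sound (r := fun a b : C => Near Λ a.1 b.1) (a := ⟨b'.1, hb'⟩)
          (b := ⟨b.1, hbC⟩) h).symm
  refine ⟨⟨?_⟩, ⟨Quot.mk _ ⟨a₀.1, h₀⟩⟩⟩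
  have hcl : ∀ a : C, a.1 ∈ X := fun a => IsCluster.subset Λ ⟨_, hc⟩ a.2
  have hall : ∀ a : C, Quot.mk (fun a b : C => Near Λ a.1 b.1) ⟨a₀.1, h₀⟩ = Quot.mk _ a :=
    fun a => key ⟨a.1, hcl a⟩
      (SimpleGraph.ConnectedComponent.exact ((hmem ⟨a.1, hcl a⟩).1 a.2)).symm a.2
  rintro ⟨a⟩ ⟨b⟩
  exact (hall a).symm.trans (hall b)

/-! ### Existence of the maximal number of clusters -/

theorem isBounded_region : Bornology.IsBounded (region Λ) := by
  have h : Bornology.IsBounded (Set.Icc Λ.lower Λ.upper) := Metric.isBounded_Icc _ _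
  have := (PiLp.lipschitzWith_toLp 2 (fun _ : Fin d => ℝ)).isBounded_image h
  refine this.subset fun x hx => ⟨WithLp.ofLp x, ?_, rfl⟩
  exact BoxIntegral.Box.coe_subset_Icc hx

/-- Two points in a common ball of radius `1/2` are within distance `1`, hence in the same cluster.
A finite cover of the bounded box by such balls therefore bounds the number of clusters. -/
theorem bddAbove_numClusters :
    BddAbove {k | ∃ X : Finset (Point d), (X : Set (Point d)) ⊆ region Λ ∧
      numClusters Λ X = k} := by
  obtain ⟨t, ht, hcov⟩ := Metric.totallyBounded_iff.1
    ((isBounded_region Λ).isCompact_closure.totallyBounded.subset subset_closure) (1 / 2)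
    (by norm_num)
  have := ht.to_subtype
  refine ⟨Nat.card t, ?_⟩
  rintro k ⟨X, hX, rfl⟩
  rw [numClusters_eq_card_quot]
  have hc : ∀ a : X, ∃ y : t, a.1 ∈ Metric.ball y.1 (1 / 2) := fun a => by
    obtain ⟨y, hy, hay⟩ := Set.mem_iUnion₂.1 (hcov (hX a.2))
    exact ⟨⟨y, hy⟩, hay⟩
  choose f hf using hc
  refine Nat.card_le_card_of_injective (fun c => f c.out) fun c c' h => ?_
  rw [← Quot.out_eq c, ← Quot.out_eq c']
  refine Quot.sound (near_of_dist_le Λ ?_)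
  have h₁ := hf c.out
  have h₂ := hf c'.out
  rw [← show f c.out = f c'.out from h] at h₂
  rw [Metric.mem_ball] at h₁ h₂
  linarith [dist_triangle_right c.out.1 c'.out.1 (f c.out).1]

theorem isGreatest_maxClusters :
    IsGreatest {k | ∃ X : Finset (Point d), (X : Set (Point d)) ⊆ region Λ ∧
      numClusters Λ X = k} (maxClusters Λ) :=
  ⟨Nat.sSup_mem ⟨_, ∅, by simp, rfl⟩ (bddAbove_numClusters Λ),
    fun _ hk => le_csSup (bddAbove_numClusters Λ) hk⟩

/-! ### Measurability -/

theorem measurableSet_region : MeasurableSet (region Λ) :=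
  Λ.measurableSet_coe.preimage (WithLp.measurable_ofLp 2 _)

theorem measurableSet_near : MeasurableSet {p : Point d × Point d | Near Λ p.1 p.2} := by
  simp only [Near, Set.ofPred_exists]
  refine MeasurableSet.iUnion fun m => IsClosed.measurableSet ?_
  exact isClosed_le (by fun_prop) continuous_const

/-- The count factors through the matrix of truth values `Near Λ (x i) (x j)`, which ranges over a
finite discrete space. -/
theorem measurable_numClusters_tupleSet {ι : Type*} [Fintype ι] :
    Measurable fun x : ι → Point d => numClusters Λ (tupleSet x) := by
  simp only [numClusters_tupleSet]
  have h : Measurable fun (x : ι → Point d) (i j : ι) => Near Λ (x i) (x j) := by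
    rw [measurable_pi_iff]
    intro i
    rw [measurable_pi_iff]
    intro j
    have hij : Measurable fun x : ι → Point d => (x i, x j) :=
      (measurable_pi_apply i).prodMk (measurable_pi_apply j)
    rw [← measurableSet_setOfPred]
    exact hij (measurableSet_near Λ)
  have hc : Measurable fun r : ι → ι → Prop => Nat.card (Quot r) := Measurable.of_discrete
  exact hc.comp h

/-- The part of the box in which no point is connected to `Y`. -/
def vacant (Y : Finset (Point d)) : Set (Point d) :=
  region Λ \ covered Λ (Y : Set (Point d))

theorem mem_vacant {Y : Finset (Point d)} {a : Point d} :
    a ∈ vacant Λ Y ↔ a ∈ region Λ ∧ ∀ y ∈ Y, ¬ Near Λ y a := by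
  simp only [vacant, covered, Set.mem_sdiff, Set.mem_ofPred_eq, Finset.mem_coe]
  constructor
  · rintro ⟨ha, h⟩
    exact ⟨ha, fun y hy hn => h ⟨ha, y, hy, hn⟩⟩
  · rintro ⟨ha, h⟩
    exact ⟨ha, fun ⟨_, y, hy, hn⟩ => h y hy hn⟩

theorem mem_vacant_tupleSet {ι : Type*} [Fintype ι] {y : ι → Point d} {a : Point d} :
    a ∈ vacant Λ (tupleSet y) ↔ a ∈ region Λ ∧ ∀ i, ¬ Near Λ (y i) a := by
  simp [mem_vacant]

theorem measurableSet_mem_vacant {α ι : Type*} [MeasurableSpace α] [Fintype ι]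
    {f : α → ι → Point d} (hf : Measurable f) {g : α → Point d} (hg : Measurable g) :
    MeasurableSet {a | g a ∈ vacant Λ (tupleSet (f a))} := by
  simp only [mem_vacant_tupleSet, Set.ofPred_and, Set.ofPred_forall]
  refine ((measurableSet_region Λ).preimage hg).inter (MeasurableSet.iInter fun i => ?_)
  exact ((measurableSet_near Λ).preimage (((measurable_pi_apply i).comp hf).prodMk hg)).compl

theorem measurableSet_vacant (Y : Finset (Point d)) : MeasurableSet (vacant Λ Y) := by
  have : tupleSet (fun y : Y => y.1) = Y := by ext; simp
  rw [← this]
  exact measurableSet_mem_vacant Λ (f := fun _ => fun y : Y => y.1) measurable_const measurable_id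

/-- Being measurable can be tested on tuples of distinct points. -/
theorem measurableSet_config_of_injective {A : Set (Config d)}
    (h : ∀ n, MeasurableSet {x : Fin n → Point d | Function.Injective x ∧ toConfig n x ∈ A}) :
    MeasurableSet A := by
  rw [measurableSet_config_iff]
  intro n
  -- Any tuple has a subtuple, selected by some `e`, that lists each of its points exactly once and
  -- yields the same configuration. There are only countably many choices of `m` and `e`.
  have : toConfig n ⁻¹' A = ⋃ m : ℕ, ⋃ e : Fin m → Fin n,
      ((⋂ i, ⋃ j, {x : Fin n → Point d | x i = x (e j)}) ∩ (fun x => x ∘ e) ⁻¹'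
        {x : Fin m → Point d | Function.Injective x ∧ toConfig m x ∈ A}) := by
    ext x
    simp only [Set.mem_preimage, Set.mem_iUnion, Set.mem_inter_iff, Set.mem_iInter,
      Set.mem_ofPred_eq]
    have himg : ∀ (m : ℕ) (e : Fin m → Fin n), (∀ i, ∃ j, x i = x (e j)) →
        toConfig m (x ∘ e) = toConfig n x := by
      intro m e he
      ext a
      rw [toConfig_points, toConfig_points, mem_tupleSet, mem_tupleSet]
      constructor
      · rintro ⟨j, rfl⟩
        exact ⟨e j, rfl⟩
      · rintro ⟨i, rfl⟩
        obtain ⟨j, hj⟩ := he i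
        exact ⟨j, hj.symm⟩
    constructor
    · intro hx
      let f := (tupleSet x).equivFin.symm
      have hf : ∀ j, ∃ i, x i = (f j).1 := fun j => mem_tupleSet.1 (f j).2
      choose e he using hf
      have hall : ∀ i, ∃ j, x i = x (e j) := fun i =>
        ⟨f.symm ⟨x i, mem_tupleSet.2 ⟨i, rfl⟩⟩, by rw [he]; simp⟩
      refine ⟨_, e, hall, fun j j' hj => ?_, (himg _ e hall).symm ▸ hx⟩
      simp only [Function.comp_apply, he] at hj
      exact f.injective (Subtype.ext hj)
    · rintro ⟨m, e, he, -, hA⟩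
      exact himg m e he ▸ hA
  rw [this]
  refine MeasurableSet.iUnion fun m => MeasurableSet.iUnion fun e => MeasurableSet.inter ?_ ?_
  · refine MeasurableSet.iInter fun i => MeasurableSet.iUnion fun j => ?_
    exact measurableSet_eq_fun (measurable_pi_apply i) (measurable_pi_apply (e j))
  · exact (h m).preimage (measurable_pi_lambda _ fun j => measurable_pi_apply (e j))

theorem measurableSet_injective (n : ℕ) :
    MeasurableSet {x : Fin n → Point d | Function.Injective x} := by
  have : {x : Fin n → Point d | Function.Injective x} =
      ⋂ i, ⋂ j, {x : Fin n → Point d | x i = x j → i = j} := by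
    ext x; simp [Function.Injective]
  rw [this]
  refine MeasurableSet.iInter fun i => MeasurableSet.iInter fun j => ?_
  by_cases hij : i = j
  · simp [hij]
  · simp only [hij, imp_false]
    exact (measurableSet_eq_fun (measurable_pi_apply i) (measurable_pi_apply j)).compl

theorem measurable_numClusters : Measurable fun X : Config d => numClusters Λ X.points := by
  refine measurable_to_countable' fun k => (measurableSet_config_iff _).2 fun n => ?_
  exact measurable_numClusters_tupleSet Λ (measurableSet_singleton k)

/-- On tuples of distinct points the cardinality is the constant `n`, so the set to be tested is
either all such tuples or empty. -/
theorem measurable_card : Measurable fun X : Config d => X.points.card := by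
  refine measurable_to_countable' fun k => measurableSet_config_of_injective fun n => ?_
  by_cases hk : n = k
  · convert measurableSet_injective (d := d) n using 3 with x
    simp only [and_iff_left_iff_imp]
    intro hx
    simp [toConfig_points, card_tupleSet hx, hk]
  · convert MeasurableSet.empty using 1
    ext x
    simp only [Set.mem_ofPred_eq, Set.mem_empty_iff_false, iff_false, not_and]
    intro hx
    simp [toConfig_points, card_tupleSet hx, hk]

theorem measurable_weight (q z : ℝ) : Measurable (weight Λ q z) := by
  have h₁ : Measurable fun k : ℕ => z ^ k := measurable_from_nat
  have h₂ : Measurable fun k : ℕ => q ^ k := measurable_from_nat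
  exact ((h₁.comp measurable_card).mul (h₂.comp (measurable_numClusters Λ))).ennreal_ofReal

/-! ### The dissociation probability -/

/-- The probability that `N` points thrown into the vacant part around `Y` form at least two
clusters. -/
def splitProb (Y : Finset (Point d)) (N : ℕ) : ENNReal :=
  uniformConfig (vacant Λ Y) N {ξ | 2 ≤ numClusters Λ ξ.points}

/-- The dissociation probability sees the cluster only through its complement and its size; hence it
stays constant while the cluster is resampled. -/
theorem dissociationProb_eq (X C : Finset (Point d)) [DecidableEq (Point d)] :
    dissociationProb Λ X C = (splitProb Λ (X \ C) C.card).toReal := by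
  rw [dissociationProb, splitProb, vacant, freeSpace, Finset.coe_sdiff, Measure.real]

theorem measurableSet_two_le : MeasurableSet {ξ : Config d | 2 ≤ numClusters Λ ξ.points} :=
  measurable_numClusters Λ measurableSet_Ici

theorem pi_restrict_apply {ι : Type*} [Fintype ι] (Δ : Set (Point d)) {s : Set (ι → Point d)}
    (hs : MeasurableSet s) :
    (Measure.pi fun _ : ι => (volume : Measure (Point d)).restrict Δ) s =
      volume {x | (∀ i, x i ∈ Δ) ∧ x ∈ s} := by
  rw [← Measure.restrict_pi_pi, Measure.restrict_apply hs]
  congr 1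
  ext x
  simp [and_comm]

/-- Relabelling is needed because the cluster will be indexed by a set of labels rather than by an
initial segment. -/
theorem splitProb_eq {ι : Type*} [Fintype ι] (Y : Finset (Point d)) :
    splitProb Λ Y (Fintype.card ι) = ((volume (vacant Λ Y)) ^ Fintype.card ι)⁻¹ *
      volume {x : ι → Point d | (∀ i, x i ∈ vacant Λ Y) ∧ 2 ≤ numClusters Λ (tupleSet x)} := by
  have hm : MeasurableSet {x : ι → Point d | 2 ≤ numClusters Λ (tupleSet x)} :=
    measurable_numClusters_tupleSet Λ measurableSet_Ici
  rw [splitProb, uniformConfig, Measure.smul_apply, smul_eq_mul,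
    Measure.map_apply (measurable_toConfig _) (measurableSet_two_le Λ)]
  congr 1
  let e := (Fintype.equivFin ι).symm
  rw [← (measurePreserving_piCongrLeft
    (fun _ : ι => (volume : Measure (Point d)).restrict (vacant Λ Y)) e).symm.measure_preimage
      (((measurableSet_two_le Λ).preimage (measurable_toConfig _)).nullMeasurableSet)]
  refine Eq.trans (congrArg _ ?_) (pi_restrict_apply (vacant Λ Y) hm)
  ext x
  have : (toConfig _ ((MeasurableEquiv.piCongrLeft (fun _ : ι => Point d) e).symm x)).points =
      tupleSet x := by
    rw [toConfig_points, ← tupleSet_comp_equiv e x]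
    rfl
  exact iff_of_eq (congrArg (fun X => 2 ≤ numClusters Λ X) this)

theorem splitProb_le_one (Y : Finset (Point d)) (N : ℕ) : splitProb Λ Y N ≤ 1 := by
  calc splitProb Λ Y N ≤ uniformConfig (vacant Λ Y) N Set.univ := measure_mono (Set.subset_univ _)
    _ = ((volume (vacant Λ Y)) ^ N)⁻¹ * (volume (vacant Λ Y)) ^ N := by
      rw [uniformConfig, Measure.smul_apply, smul_eq_mul,
        Measure.map_apply (measurable_toConfig _) MeasurableSet.univ, Set.preimage_univ,
        Measure.pi_univ]
      simp
    _ ≤ 1 := ENNReal.inv_mul_le_one _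

theorem measurable_splitProb {ι : Type*} [Fintype ι] (N : ℕ) :
    Measurable fun y : ι → Point d => splitProb Λ (tupleSet y) N := by
  have h := fun y : ι → Point d => splitProb_eq (ι := Fin N) Λ (tupleSet y)
  simp only [Fintype.card_fin] at h
  simp only [h]
  refine Measurable.mul (Measurable.inv (Measurable.pow_const ?_ _)) ?_
  · exact measurable_measure_prodMk_left
      (s := {p : (ι → Point d) × Point d | p.2 ∈ vacant Λ (tupleSet p.1)})
      (measurableSet_mem_vacant Λ measurable_fst measurable_snd)
  · refine measurable_measure_prodMk_left (ν := (volume : Measure (Fin N → Point d)))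
      (s := {p : (ι → Point d) × (Fin N → Point d) | (∀ i, p.2 i ∈ vacant Λ (tupleSet p.1)) ∧
        2 ≤ numClusters Λ (tupleSet p.2)}) ?_
    rw [Set.ofPred_and]
    refine MeasurableSet.inter ?_ ?_
    · rw [Set.ofPred_forall]
      exact MeasurableSet.iInter fun i => measurableSet_mem_vacant Λ measurable_fst
        ((measurable_pi_apply i).comp measurable_snd)
    · exact ((measurable_numClusters_tupleSet Λ).comp measurable_snd) measurableSet_Ici

/-! ### Resampling a cluster inside its free space -/

/-- Lebesgue measure on families of points of the box. -/
abbrev tupleMeasure (ι : Type*) [Fintype ι] : Measure (ι → Point d) :=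
  Measure.pi fun _ : ι => (volume : Measure (Point d)).restrict (region Λ)

/-- The weight of a family `u` forming a single cluster isolated from `Y`, times its
dissociation probability. -/
def clusterWeight (Q : ENNReal) {ι : Type*} [Fintype ι] (Y : Finset (Point d))
    (u : ι → Point d) : ENNReal :=
  {u : ι → Point d | (∀ i, u i ∈ vacant Λ Y) ∧ numClusters Λ (tupleSet u) = 1}.indicator
    (fun _ => Q ^ (numClusters Λ Y + 1) * splitProb Λ Y (Fintype.card ι)) u

/-- The weight of a family `u` isolated from `Y`. -/
def isolatedWeight (Q : ENNReal) {ι : Type*} [Fintype ι] (Y : Finset (Point d))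
    (u : ι → Point d) : ENNReal :=
  {u : ι → Point d | ∀ i, u i ∈ vacant Λ Y}.indicator
    (fun u => Q ^ (numClusters Λ (tupleSet u) + numClusters Λ Y)) u

theorem measurableSet_forall_mem_vacant {α ι κ : Type*} [MeasurableSpace α] [Fintype ι] [Fintype κ]
    {f : α → κ → Point d} (hf : Measurable f) {g : α → ι → Point d} (hg : Measurable g) :
    MeasurableSet {a | ∀ i, g a i ∈ vacant Λ (tupleSet (f a))} := by
  rw [Set.ofPred_forall]
  exact MeasurableSet.iInter fun i => measurableSet_mem_vacant Λ hf
    ((measurable_pi_apply i).comp hg)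

theorem measurableSet_pi_vacant {ι : Type*} [Fintype ι] (Y : Finset (Point d)) :
    MeasurableSet {u : ι → Point d | ∀ i, u i ∈ vacant Λ Y} := by
  rw [Set.ofPred_forall]
  exact MeasurableSet.iInter fun i => (measurableSet_vacant Λ Y).preimage (measurable_pi_apply i)

theorem measurable_pow_numClusters (Q : ENNReal) {ι : Type*} [Fintype ι] :
    Measurable fun u : ι → Point d => Q ^ numClusters Λ (tupleSet u) :=
  (measurable_from_nat (f := fun k => Q ^ k)).comp (measurable_numClusters_tupleSet Λ)

theorem measurable_clusterWeight (Q : ENNReal) {α ι κ : Type*} [MeasurableSpace α] [Fintype ι]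
    [Fintype κ] {f : α → κ → Point d} (hf : Measurable f) {g : α → ι → Point d}
    (hg : Measurable g) : Measurable fun a => clusterWeight Λ Q (tupleSet (f a)) (g a) := by
  have hs : MeasurableSet {a | (∀ i, g a i ∈ vacant Λ (tupleSet (f a))) ∧
      numClusters Λ (tupleSet (g a)) = 1} := by
    rw [Set.ofPred_and]
    refine (measurableSet_forall_mem_vacant Λ hf hg).inter ?_
    exact ((measurable_numClusters_tupleSet Λ).comp hg) (measurableSet_singleton 1)
  have hw : Measurable fun a => Q ^ (numClusters Λ (tupleSet (f a)) + 1) *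
      splitProb Λ (tupleSet (f a)) (Fintype.card ι) := by
    simp only [pow_succ]
    exact (((measurable_pow_numClusters Λ Q).comp hf).mul_const _).mul
      ((measurable_splitProb Λ _).comp hf)
  exact hw.indicator hs

theorem measurable_isolatedWeight (Q : ENNReal) {α ι κ : Type*} [MeasurableSpace α] [Fintype ι]
    [Fintype κ] {f : α → κ → Point d} (hf : Measurable f) {g : α → ι → Point d}
    (hg : Measurable g) : Measurable fun a => isolatedWeight Λ Q (tupleSet (f a)) (g a) := by
  have hw : Measurable fun a =>
      Q ^ (numClusters Λ (tupleSet (g a)) + numClusters Λ (tupleSet (f a))) := by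
    simp only [pow_add]
    exact ((measurable_pow_numClusters Λ Q).comp hg).mul
      ((measurable_pow_numClusters Λ Q).comp hf)
  exact hw.indicator (measurableSet_forall_mem_vacant Λ hf hg)

/-- The vacant part lies in the box, so the restriction to the box has no effect. -/
theorem tupleMeasure_inter_vacant {ι : Type*} [Fintype ι] (Y : Finset (Point d))
    {s : Set (ι → Point d)} (hs : MeasurableSet s) :
    tupleMeasure Λ ι {u | (∀ i, u i ∈ vacant Λ Y) ∧ u ∈ s} =
      volume {u : ι → Point d | (∀ i, u i ∈ vacant Λ Y) ∧ u ∈ s} := by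
  refine (pi_restrict_apply _ ((measurableSet_pi_vacant Λ Y).inter hs)).trans (congrArg _ ?_)
  ext u
  exact ⟨fun h => h.2, fun h => ⟨fun i => ((mem_vacant Λ).1 (h.1 i)).1, h⟩⟩

theorem volume_pi_vacant {ι : Type*} [Fintype ι] (Y : Finset (Point d)) :
    volume {u : ι → Point d | ∀ i, u i ∈ vacant Λ Y} =
      volume (vacant Λ Y) ^ Fintype.card ι := by
  have : {u : ι → Point d | ∀ i, u i ∈ vacant Λ Y} = Set.univ.pi fun _ => vacant Λ Y := by
    ext; simp
  rw [this, volume_pi_pi]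
  simp

/-- This is the resampling step: the split probability times the volume of all isolated positions is
at most the volume of those positions with at least two clusters, where an additional factor `Q` is
available. -/
theorem lintegral_clusterWeight_le {Q : ENNReal} (hQ : 1 ≤ Q) (hQ' : Q ≠ ⊤) {ι : Type*}
    [Fintype ι] (Y : Finset (Point d)) :
    ∫⁻ u : ι → Point d, clusterWeight Λ Q Y u ∂tupleMeasure Λ ι ≤
      Q⁻¹ * ∫⁻ u : ι → Point d, isolatedWeight Λ Q Y u ∂tupleMeasure Λ ι := by
  have h2 : MeasurableSet {u : ι → Point d | 2 ≤ numClusters Λ (tupleSet u)} :=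
    measurable_numClusters_tupleSet Λ measurableSet_Ici
  have h1 : MeasurableSet {u : ι → Point d | numClusters Λ (tupleSet u) = 1} :=
    measurable_numClusters_tupleSet Λ (measurableSet_singleton 1)
  have hQ0 : Q ≠ 0 := (zero_lt_one.trans_le hQ).ne'
  set V := volume (vacant Λ Y) ^ Fintype.card ι
  set c := Q ^ (numClusters Λ Y + 1)
  set D := {u : ι → Point d | (∀ i, u i ∈ vacant Λ Y) ∧ 2 ≤ numClusters Λ (tupleSet u)}
  have hD : MeasurableSet D := (measurableSet_pi_vacant Λ Y).inter h2
  calc ∫⁻ u : ι → Point d, clusterWeight Λ Q Y u ∂tupleMeasure Λ ι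
      ≤ (c * splitProb Λ Y (Fintype.card ι)) * V := by
        refine (lintegral_indicator_const_le _ _).trans ?_
        gcongr
        refine (tupleMeasure_inter_vacant Λ Y h1).trans_le ?_
        exact (measure_mono fun u hu => hu.1).trans_eq (volume_pi_vacant Λ Y)
    _ = (V⁻¹ * V) * (c * volume D) := by
        rw [splitProb_eq]
        ring
    -- An inequality suffices, so a vacant part of volume zero needs no separate treatment.
    _ ≤ 1 * (c * volume D) := by
        gcongr
        exact ENNReal.inv_mul_le_one _
    _ = ∫⁻ u, D.indicator (fun _ => c) u ∂tupleMeasure Λ ι := by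
        rw [lintegral_indicator_const hD, one_mul]
        exact congrArg (c * ·) (tupleMeasure_inter_vacant Λ Y h2).symm
    _ ≤ ∫⁻ u : ι → Point d, Q⁻¹ * isolatedWeight Λ Q Y u ∂tupleMeasure Λ ι := by
        refine lintegral_mono (Set.indicator_le' (fun u hu => ?_) fun _ _ => zero_le)
        have hu₁ : u ∈ {u : ι → Point d | ∀ i, u i ∈ vacant Λ Y} := hu.1
        rw [isolatedWeight, Set.indicator_of_mem hu₁]
        calc c = Q⁻¹ * (Q * c) := by
              rw [← mul_assoc, ENNReal.inv_mul_cancel hQ0 hQ', one_mul]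
          _ ≤ _ := by
              gcongr
              rw [← pow_succ']
              -- On `D` there are at least two clusters in `u`, one more than the single cluster
              -- counted in `c`; this is where `1 ≤ Q` enters.
              refine pow_le_pow_right₀ hQ ?_
              have := hu.2
              omega
    _ = Q⁻¹ * ∫⁻ u : ι → Point d, isolatedWeight Λ Q Y u ∂tupleMeasure Λ ι :=
        lintegral_const_mul' _ _ (ENNReal.inv_ne_top.2 hQ0)

/-- Integration over a family, first over the entries in `S`. -/
theorem lintegral_tuple_split {ι : Type*} [Fintype ι] [DecidableEq ι] (S : Finset ι)
    {F : ({i // i ∈ S} → Point d) × ({i // i ∉ S} → Point d) → ENNReal} (hF : Measurable F) :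
    ∫⁻ x, F (fun i => x i, fun i => x i) ∂tupleMeasure Λ ι =
      ∫⁻ v, ∫⁻ u, F (u, v) ∂tupleMeasure Λ {i // i ∈ S} ∂tupleMeasure Λ {i // i ∉ S} := by
  rw [← lintegral_prod_symm' F hF]
  convert (measurePreserving_piEquivPiSubtypeProd
    (fun _ : ι => (volume : Measure (Point d)).restrict (region Λ)) (· ∈ S)).lintegral_comp hF <;> rfl

theorem lintegral_clusterWeight_split_le {Q : ENNReal} (hQ : 1 ≤ Q) (hQ' : Q ≠ ⊤) {ι : Type*}
    [Fintype ι] [DecidableEq ι] (S : Finset ι) :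
    ∫⁻ x, clusterWeight Λ Q (tupleSet fun i : {i // i ∉ S} => x i)
        (fun i : {i // i ∈ S} => x i) ∂tupleMeasure Λ ι ≤
      Q⁻¹ * ∫⁻ x, isolatedWeight Λ Q (tupleSet fun i : {i // i ∉ S} => x i)
        (fun i : {i // i ∈ S} => x i) ∂tupleMeasure Λ ι := by
  have h₁ := lintegral_tuple_split Λ S
    (F := fun p => clusterWeight Λ Q (tupleSet p.2) p.1)
    (measurable_clusterWeight Λ Q measurable_snd measurable_fst)
  have h₂ := lintegral_tuple_split Λ S
    (F := fun p => isolatedWeight Λ Q (tupleSet p.2) p.1)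
    (measurable_isolatedWeight Λ Q measurable_snd measurable_fst)
  rw [h₁, h₂,
    ← lintegral_const_mul' _ _ (ENNReal.inv_ne_top.2 (zero_lt_one.trans_le hQ).ne')]
  exact lintegral_mono fun v : {i // i ∉ S} → Point d =>
    lintegral_clusterWeight_le (ι := {i // i ∈ S}) Λ hQ hQ' (tupleSet v)

/-! ### Almost sure properties of tuples -/

theorem tupleMeasure_eq_restrict (ι : Type*) [Fintype ι] :
    tupleMeasure Λ ι = (volume : Measure (ι → Point d)).restrict
      (Set.univ.pi fun _ => region Λ) :=
  (Measure.restrict_pi_pi _ _).symm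

theorem ae_mem_region (ι : Type*) [Fintype ι] :
    ∀ᵐ x ∂tupleMeasure Λ ι, ∀ i, x i ∈ region Λ := by
  rw [tupleMeasure_eq_restrict]
  filter_upwards [ae_restrict_mem (MeasurableSet.univ_pi fun _ : ι => measurableSet_region Λ)]
    with x hx i using hx i (Set.mem_univ i)

/-- For `i ≠ j` the coincidence set `x i = x j` is a proper linear subspace, hence a null set. -/
theorem ae_injective (hd : 0 < d) (ι : Type*) [Fintype ι] :
    ∀ᵐ x ∂tupleMeasure Λ ι, Function.Injective x := by
  rw [tupleMeasure_eq_restrict]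
  refine ae_restrict_of_ae ?_
  have h : ∀ i j : ι, i ≠ j → ∀ᵐ x : ι → Point d, x i ≠ x j := by
    intro i j hij
    classical
    let E : Submodule ℝ (ι → Point d) :=
      LinearMap.ker ((LinearMap.proj i : (ι → Point d) →ₗ[ℝ] Point d) - LinearMap.proj j)
    have hE : E ≠ ⊤ := by
      intro h
      let v : Point d := EuclideanSpace.single ⟨0, hd⟩ 1
      have hv : Pi.single i v ∈ E := h ▸ Submodule.mem_top
      have : v = 0 := by simpa [E, hij.symm] using hv
      simp [v] at this
    rw [ae_iff]
    convert Measure.addHaar_submodule volume E hE using 2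
    ext x
    simp [E, sub_eq_zero]
  have h' : ∀ᵐ x : ι → Point d, ∀ i j : ι, i ≠ j → x i ≠ x j := by
    refine ae_all_iff.2 fun i => ae_all_iff.2 fun j => ?_
    by_cases hij : i = j
    · simp [hij]
    · filter_upwards [h i j hij] with x hx _ using hx
  filter_upwards [h'] with x hx i j hij
  by_contra hne
  exact hx i j hne hij

/-! ### Configurations with an easily dissociating cluster -/

/-- Configurations in which some isolated single cluster dissociates with probability at
least `δ`. -/
def dissociating (δ : ENNReal) : Set (Config d) :=
  open Classical in {X | ∃ C ⊆ X.points, (∀ a ∈ C, a ∈ vacant Λ (X.points \ C)) ∧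
    numClusters Λ C = 1 ∧ δ ≤ splitProb Λ (X.points \ C) C.card}

/-- The tuples whose entries in `S` form an isolated single cluster that dissociates with
probability at least `δ`. -/
def dissociatingTuples {ι : Type*} [Fintype ι] [DecidableEq ι] (δ : ENNReal) (S : Finset ι) :
    Set (ι → Point d) :=
  {x | ((∀ i : {i // i ∈ S}, x i ∈ vacant Λ (tupleSet fun i : {i // i ∉ S} => x i)) ∧
    numClusters Λ (tupleSet fun i : {i // i ∈ S} => x i) = 1) ∧
    δ ≤ splitProb Λ (tupleSet fun i : {i // i ∉ S} => x i) (Fintype.card {i // i ∈ S})}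

theorem measurable_subtuple {ι : Type*} (p : ι → Prop) :
    Measurable fun (x : ι → Point d) (i : {i // p i}) => x i :=
  measurable_pi_lambda _ fun i => measurable_pi_apply i.1

theorem measurableSet_dissociatingTuples {ι : Type*} [Fintype ι] [DecidableEq ι] (δ : ENNReal)
    (S : Finset ι) : MeasurableSet (dissociatingTuples Λ δ S) := by
  rw [dissociatingTuples, Set.ofPred_and, Set.ofPred_and]
  refine MeasurableSet.inter (MeasurableSet.inter ?_ ?_) ?_
  · exact measurableSet_forall_mem_vacant Λ (measurable_subtuple (· ∉ S))
      (measurable_subtuple (· ∈ S))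
  · exact ((measurable_numClusters_tupleSet Λ).comp (measurable_subtuple (· ∈ S)))
      (measurableSet_singleton 1)
  · exact ((measurable_splitProb Λ _).comp (measurable_subtuple (· ∉ S))) measurableSet_Ici

/-- For distinct points, subconfigurations correspond to sets of labels. Injectivity makes
complements and cardinalities agree on both sides. -/
theorem toConfig_mem_dissociating_iff {δ : ENNReal} {n : ℕ} {x : Fin n → Point d}
    (hx : Function.Injective x) :
    toConfig n x ∈ dissociating Λ δ ↔ ∃ S, x ∈ dissociatingTuples Λ δ S := by
  classical
  have hsub : ∀ S : Finset (Fin n), tupleSet x \ tupleSet (fun i : {i // i ∈ S} => x i) =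
      tupleSet fun i : {i // i ∉ S} => x i := by
    intro S
    ext a
    simp only [Finset.mem_sdiff, mem_tupleSet, Subtype.exists, exists_prop, not_exists, not_and]
    constructor
    · rintro ⟨⟨i, rfl⟩, h⟩
      exact ⟨i, fun hi => h i hi rfl, rfl⟩
    · rintro ⟨i, hi, rfl⟩
      exact ⟨⟨i, rfl⟩, fun j hj hji => hi (hx hji ▸ hj)⟩
  have hcard : ∀ S : Finset (Fin n), (tupleSet fun i : {i // i ∈ S} => x i).card =
      Fintype.card {i // i ∈ S} := fun S => card_tupleSet (hx.comp Subtype.val_injective)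
  simp only [dissociating, dissociatingTuples, Set.mem_ofPred_eq, toConfig_points]
  constructor
  · rintro ⟨C, hC, h⟩
    let S : Finset (Fin n) := Finset.univ.filter fun i => x i ∈ C
    have hS : (tupleSet fun i : {i // i ∈ S} => x i) = C := by
      ext a
      simp only [mem_tupleSet, Subtype.exists, exists_prop, S, Finset.mem_filter,
        Finset.mem_univ, true_and]
      constructor
      · rintro ⟨i, hi, rfl⟩
        exact hi
      · intro ha
        obtain ⟨i, rfl⟩ := mem_tupleSet.1 (hC ha)
        exact ⟨i, ha, rfl⟩
    refine ⟨S, ?_⟩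
    rw [← hsub, ← hcard, hS]
    exact ⟨⟨fun i => h.1 _ (Finset.mem_filter.1 i.2).2, h.2.1⟩, h.2.2⟩
  · rintro ⟨S, h⟩
    refine ⟨tupleSet fun i : {i // i ∈ S} => x i, ?_, ?_, h.1.2, ?_⟩
    · intro a ha
      obtain ⟨i, rfl⟩ := mem_tupleSet.1 ha
      exact mem_tupleSet.2 ⟨i, rfl⟩
    · intro a ha
      obtain ⟨i, rfl⟩ := mem_tupleSet.1 ha
      rw [hsub]
      exact h.1.1 i
    · rw [hsub, hcard]
      exact h.2

theorem measurableSet_dissociating (δ : ENNReal) : MeasurableSet (dissociating Λ δ) := by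
  refine measurableSet_config_of_injective fun n => ?_
  have : {x : Fin n → Point d | Function.Injective x ∧ toConfig n x ∈ dissociating Λ δ} =
      {x | Function.Injective x} ∩ ⋃ S, dissociatingTuples Λ δ S := by
    ext x
    simp only [Set.mem_ofPred_eq, Set.mem_inter_iff, Set.mem_iUnion]
    exact and_congr_right fun hx => toConfig_mem_dissociating_iff Λ hx
  rw [this]
  exact (measurableSet_injective n).inter
    (MeasurableSet.iUnion fun S => measurableSet_dissociatingTuples Λ δ S)

/-- The event of the theorem is enlarged to one whose measurability is known, keeping only the
properties of a cluster that the estimate uses. -/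
theorem mem_dissociating {X : Config d} (hX : (X.points : Set (Point d)) ⊆ region Λ) {δ : ℝ}
    {C : Finset (Point d)} (hC : IsCluster Λ X.points C)
    (hδ : δ ≤ dissociationProb Λ X.points C) : X ∈ dissociating Λ (ENNReal.ofReal δ) := by
  classical
  rw [dissociationProb_eq] at hδ
  have hs := IsCluster.subset Λ hC
  refine ⟨C, hs, fun a ha => (mem_vacant Λ).2 ⟨hX (hs ha), fun y hy => ?_⟩,
    IsCluster.numClusters_eq_one Λ hC, ?_⟩
  · rw [Finset.mem_sdiff] at hy
    exact IsCluster.not_near Λ hC ha hy.1 hy.2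
  · convert ENNReal.ofReal_le_of_le_toReal hδ

theorem dissociationProb_le_one (X C : Finset (Point d)) : dissociationProb Λ X C ≤ 1 := by
  classical
  rw [dissociationProb_eq]
  exact ENNReal.toReal_le_of_le_ofReal zero_le_one (by simpa using splitProb_le_one Λ _ _)

/-! ### The estimate for a fixed number of points -/

/-- A Markov-type bound: the labels of a dissociating cluster give one term of the sum that is
already at least `δ * Q^k`, by additivity of `k` over separated parts. -/
theorem mul_pow_le_sum_clusterWeight {n : ℕ} (Q δ : ENNReal) {x : Fin n → Point d}
    (hx : Function.Injective x) :
    δ * (dissociating Λ δ).indicator (fun X => Q ^ numClusters Λ X.points) (toConfig n x) ≤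
      ∑ S : Finset (Fin n), clusterWeight Λ Q (tupleSet fun i : {i // i ∉ S} => x i)
        (fun i : {i // i ∈ S} => x i) := by
  by_cases hA : toConfig n x ∈ dissociating Λ δ
  · rw [Set.indicator_of_mem hA]
    obtain ⟨S, ⟨hS, hδ⟩⟩ := (toConfig_mem_dissociating_iff Λ hx).1 hA
    refine le_trans ?_ (Finset.single_le_sum (fun _ _ => zero_le) (Finset.mem_univ S))
    have hmem : (fun i : {i // i ∈ S} => x i) ∈ {u : {i // i ∈ S} → Point d |
      (∀ i, u i ∈ vacant Λ (tupleSet fun i : {i // i ∉ S} => x i)) ∧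
        numClusters Λ (tupleSet u) = 1} := hS
    rw [clusterWeight, Set.indicator_of_mem hmem, mul_comm, toConfig_points,
      ← numClusters_tupleSet_add Λ x S, hS.2, add_comm 1]
    · gcongr
    · intro i hi j hj
      exact ((mem_vacant_tupleSet Λ).1 (hS.1 ⟨i, hi⟩)).2 ⟨j, hj⟩
  · rw [Set.indicator_of_notMem hA, mul_zero]
    exact zero_le

/-- By additivity every separated `S` contributes exactly `Q^k`, and all other `S` contribute
nothing. It remains to count the separated ones. -/
theorem sum_isolatedWeight_le {n : ℕ} (Q : ENNReal) {x : Fin n → Point d}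
    (hx : ∀ i, x i ∈ region Λ) :
    ∑ S : Finset (Fin n), isolatedWeight Λ Q (tupleSet fun i : {i // i ∉ S} => x i)
        (fun i : {i // i ∈ S} => x i) ≤
      2 ^ maxClusters Λ * Q ^ numClusters Λ (tupleSet x) := by
  classical
  have hle : ∀ S : Finset (Fin n), isolatedWeight Λ Q (tupleSet fun i : {i // i ∉ S} => x i)
      (fun i : {i // i ∈ S} => x i) ≤
        if ∀ i ∈ S, ∀ j ∉ S, ¬ Near Λ (x j) (x i) then Q ^ numClusters Λ (tupleSet x) else 0 := by
    intro S
    by_cases hS : (fun i : {i // i ∈ S} => x i) ∈ {u : {i // i ∈ S} → Point d |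
      ∀ i, u i ∈ vacant Λ (tupleSet fun i : {i // i ∉ S} => x i)}
    · have hsep : ∀ i ∈ S, ∀ j ∉ S, ¬ Near Λ (x j) (x i) := fun i hi j hj =>
        ((mem_vacant_tupleSet Λ).1 (hS ⟨i, hi⟩)).2 ⟨j, hj⟩
      rw [isolatedWeight, Set.indicator_of_mem hS, if_pos hsep, numClusters_tupleSet_add Λ x S hsep]
    · rw [isolatedWeight, Set.indicator_of_notMem hS]
      exact zero_le
  refine (Finset.sum_le_sum fun S _ => hle S).trans ?_
  rw [← Finset.sum_filter, Finset.sum_const, nsmul_eq_mul]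
  gcongr
  have h₁ := card_separated_le Λ x
  rw [Nat.card_eq_fintype_card, Fintype.card_subtype] at h₁
  have h₂ : numClusters Λ (tupleSet x) ≤ maxClusters Λ := (isGreatest_maxClusters Λ).2
    ⟨tupleSet x, fun a ha => by obtain ⟨i, rfl⟩ := mem_tupleSet.1 ha; exact hx i, rfl⟩
  exact_mod_cast h₁.trans (Nat.pow_le_pow_right two_pos h₂)

theorem lintegral_dissociating_le (hd : 0 < d) {Q : ENNReal} (hQ : 1 ≤ Q) (hQ' : Q ≠ ⊤)
    (δ : ENNReal) (hδ : δ ≠ ⊤) (n : ℕ) :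
    δ * ∫⁻ x, (dissociating Λ δ).indicator (fun X => Q ^ numClusters Λ X.points) (toConfig n x)
        ∂tupleMeasure Λ (Fin n) ≤
      Q⁻¹ * 2 ^ maxClusters Λ *
        ∫⁻ x, Q ^ numClusters Λ (tupleSet x) ∂tupleMeasure Λ (Fin n) := by
  have hm₁ : ∀ S : Finset (Fin n), Measurable fun x : Fin n → Point d =>
      clusterWeight Λ Q (tupleSet fun i : {i // i ∉ S} => x i) (fun i : {i // i ∈ S} => x i) :=
    fun S => measurable_clusterWeight Λ Q (measurable_subtuple (· ∉ S)) (measurable_subtuple (· ∈ S))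
  have hm₂ : ∀ S : Finset (Fin n), Measurable fun x : Fin n → Point d =>
      isolatedWeight Λ Q (tupleSet fun i : {i // i ∉ S} => x i) (fun i : {i // i ∈ S} => x i) :=
    fun S => measurable_isolatedWeight Λ Q (measurable_subtuple (· ∉ S)) (measurable_subtuple (· ∈ S))
  rw [← lintegral_const_mul' _ _ hδ]
  calc _ ≤ ∫⁻ x, ∑ S : Finset (Fin n), clusterWeight Λ Q
          (tupleSet fun i : {i // i ∉ S} => x i) (fun i : {i // i ∈ S} => x i)
          ∂tupleMeasure Λ (Fin n) := by
        refine lintegral_mono_ae ?_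
        filter_upwards [ae_injective Λ hd (Fin n)] with x hx
        exact mul_pow_le_sum_clusterWeight Λ Q δ hx
    _ ≤ Q⁻¹ * ∫⁻ x, ∑ S : Finset (Fin n), isolatedWeight Λ Q
          (tupleSet fun i : {i // i ∉ S} => x i) (fun i : {i // i ∈ S} => x i)
          ∂tupleMeasure Λ (Fin n) := by
        rw [lintegral_finsetSum _ fun S _ => hm₁ S, lintegral_finsetSum _ fun S _ => hm₂ S,
          Finset.mul_sum]
        exact Finset.sum_le_sum fun S _ => lintegral_clusterWeight_split_le Λ hQ hQ' S
    _ ≤ Q⁻¹ * ∫⁻ x, 2 ^ maxClusters Λ * Q ^ numClusters Λ (tupleSet x)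
          ∂tupleMeasure Λ (Fin n) := by
        gcongr Q⁻¹ * ?_
        refine lintegral_mono_ae ?_
        filter_upwards [ae_mem_region Λ (Fin n)] with x hx
        exact sum_isolatedWeight_le Λ Q hx
    _ = _ := by
        rw [lintegral_const_mul _ (measurable_pow_numClusters Λ Q), mul_assoc]

/-! ### The random-cluster measure -/

theorem lintegral_lebesguePoisson {F : Config d → ENNReal} (hF : Measurable F) :
    ∫⁻ X, F X ∂lebesguePoisson Λ = ∑' n : ℕ, (Nat.factorial n : ENNReal)⁻¹ *
      ∫⁻ x, F (toConfig n x) ∂tupleMeasure Λ (Fin n) := by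
  rw [lebesguePoisson, lintegral_sum_measure]
  congr 1
  ext n
  rw [lintegral_smul_measure, lintegral_map hF (measurable_toConfig n), smul_eq_mul]

theorem weight_eq {q z : ℝ} (hq : 0 < q) (hz : 0 < z) (X : Config d) :
    weight Λ q z X = ENNReal.ofReal z ^ X.points.card *
      ENNReal.ofReal q ^ numClusters Λ X.points := by
  rw [weight, ENNReal.ofReal_mul (by positivity), ENNReal.ofReal_pow hz.le,
    ENNReal.ofReal_pow hq.le]

theorem weight_toConfig {q z : ℝ} (hq : 0 < q) (hz : 0 < z) {n : ℕ} {x : Fin n → Point d}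
    (hx : Function.Injective x) :
    weight Λ q z (toConfig n x) = ENNReal.ofReal z ^ n *
      ENNReal.ofReal q ^ numClusters Λ (tupleSet x) := by
  rw [weight_eq Λ hq hz, toConfig_points, card_tupleSet hx, Fintype.card_fin]

theorem lintegral_weight_toConfig (hd : 0 < d) {q z : ℝ} (hq : 0 < q) (hz : 0 < z) (n : ℕ) :
    ∫⁻ x, weight Λ q z (toConfig n x) ∂tupleMeasure Λ (Fin n) = ENNReal.ofReal z ^ n *
      ∫⁻ x, ENNReal.ofReal q ^ numClusters Λ (tupleSet x) ∂tupleMeasure Λ (Fin n) := by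
  rw [← lintegral_const_mul' _ _ (by finiteness)]
  refine lintegral_congr_ae ?_
  filter_upwards [ae_injective Λ hd (Fin n)] with x hx using weight_toConfig Λ hq hz hx

/-- The empty configuration alone contributes `1`. -/
theorem partitionFunction_ne_zero (q z : ℝ) : partitionFunction Λ q z ≠ 0 := by
  rw [partitionFunction, lintegral_lebesguePoisson Λ (measurable_weight Λ q z)]
  refine (lt_of_lt_of_le ?_ (ENNReal.le_tsum 0)).ne'
  have h : ∀ x : Fin 0 → Point d, weight Λ q z (toConfig 0 x) = 1 := fun x => by
    have hx : (toConfig 0 x).points = ∅ := by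
      ext a
      simp [toConfig_points]
    rw [weight, hx, numClusters_empty]
    simp
  simp [h]

/-- The base `1 + q` is at least `1`, so the bound is monotone in the exponent even when `q < 1`. -/
theorem pow_numClusters_le (q : ℝ) {X : Finset (Point d)}
    (hX : (X : Set (Point d)) ⊆ region Λ) :
    ENNReal.ofReal q ^ numClusters Λ X ≤ (1 + ENNReal.ofReal q) ^ maxClusters Λ :=
  calc ENNReal.ofReal q ^ numClusters Λ X ≤ (1 + ENNReal.ofReal q) ^ numClusters Λ X := by
        gcongr
        exact le_add_self
    _ ≤ _ := pow_le_pow_right₀ le_self_add ((isGreatest_maxClusters Λ).2 ⟨X, hX, rfl⟩)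

/-- The series is dominated by a constant times the exponential series at `z` times the volume of
the box. -/
theorem partitionFunction_ne_top (hd : 0 < d) {q z : ℝ} (hq : 0 < q) (hz : 0 < z) :
    partitionFunction Λ q z ≠ ⊤ := by
  rw [partitionFunction, lintegral_lebesguePoisson Λ (measurable_weight Λ q z)]
  set K := (1 + ENNReal.ofReal q) ^ maxClusters Λ
  set v := volume (region Λ)
  have hv : v ≠ ⊤ := (isBounded_region Λ).measure_lt_top.ne
  have hK : K ≠ ⊤ := by finiteness
  have hterm : ∀ n : ℕ, (Nat.factorial n : ENNReal)⁻¹ *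
      ∫⁻ x, weight Λ q z (toConfig n x) ∂tupleMeasure Λ (Fin n) ≤
        K * ENNReal.ofReal ((z * v.toReal) ^ n / (Nat.factorial n : ℝ)) := by
    intro n
    rw [lintegral_weight_toConfig Λ hd hq hz]
    have hint : ∫⁻ x, ENNReal.ofReal q ^ numClusters Λ (tupleSet x) ∂tupleMeasure Λ (Fin n) ≤
        K * v ^ n := by
      calc _ ≤ ∫⁻ _, K ∂tupleMeasure Λ (Fin n) := by
            refine lintegral_mono_ae ?_
            filter_upwards [ae_mem_region Λ (Fin n)] with x hx
            refine pow_numClusters_le Λ q fun a ha => ?_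
            obtain ⟨i, rfl⟩ := mem_tupleSet.1 ha
            exact hx i
        _ = K * v ^ n := by
            rw [lintegral_const, Measure.pi_univ]
            simp [v]
    have hfac : (0 : ℝ) < Nat.factorial n := by exact_mod_cast Nat.factorial_pos n
    rw [ENNReal.ofReal_div_of_pos hfac, ENNReal.ofReal_natCast,
      ENNReal.ofReal_pow (by positivity), ENNReal.ofReal_mul hz.le, ENNReal.ofReal_toReal hv,
      mul_pow, div_eq_mul_inv]
    calc _ ≤ (Nat.factorial n : ENNReal)⁻¹ * (ENNReal.ofReal z ^ n * (K * v ^ n)) := by gcongr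
      _ = _ := by ring
  refine ne_top_of_le_ne_top ?_ (ENNReal.tsum_le_tsum hterm)
  rw [ENNReal.tsum_mul_left, ← ENNReal.ofReal_tsum_of_nonneg (fun n => by positivity)
    (Real.summable_pow_div_factorial _)]
  finiteness

theorem isProbabilityMeasure_randomCluster (hd : 0 < d) {q z : ℝ} (hq : 0 < q) (hz : 0 < z) :
    IsProbabilityMeasure (randomCluster Λ q z) := by
  refine ⟨?_⟩
  rw [randomCluster, Measure.smul_apply, withDensity_apply _ MeasurableSet.univ,
    Measure.restrict_univ, smul_eq_mul]
  exact ENNReal.inv_mul_cancel (partitionFunction_ne_zero Λ q z)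
    (partitionFunction_ne_top Λ hd hq hz)

/-- The factors `z^n / n!` depend only on the number of points, which resampling preserves, so the
estimate can be applied term by term in `n`. -/
theorem mul_randomCluster_dissociating_le (hd : 0 < d) {q z : ℝ} (hq : 1 ≤ q) (hz : 0 < z)
    {δ : ENNReal} (hδ : δ ≠ ⊤) :
    δ * randomCluster Λ q z (dissociating Λ δ) ≤
      (ENNReal.ofReal q)⁻¹ * 2 ^ maxClusters Λ := by
  have hq0 : 0 < q := zero_lt_one.trans_le hq
  set K := (ENNReal.ofReal q)⁻¹ * 2 ^ maxClusters Λ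
  have hA := measurableSet_dissociating Λ δ
  have key : δ * ∫⁻ X in dissociating Λ δ, weight Λ q z X ∂lebesguePoisson Λ ≤
      K * partitionFunction Λ q z := by
    rw [← lintegral_indicator hA, partitionFunction,
      lintegral_lebesguePoisson Λ (measurable_weight Λ q z),
      lintegral_lebesguePoisson Λ ((measurable_weight Λ q z).indicator hA),
      ← ENNReal.tsum_mul_left, ← ENNReal.tsum_mul_left]
    refine ENNReal.tsum_le_tsum fun n => ?_
    have hn : ∫⁻ x, (dissociating Λ δ).indicator (weight Λ q z) (toConfig n x)
        ∂tupleMeasure Λ (Fin n) = ENNReal.ofReal z ^ n *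
          ∫⁻ x, (dissociating Λ δ).indicator
            (fun X => ENNReal.ofReal q ^ numClusters Λ X.points) (toConfig n x)
            ∂tupleMeasure Λ (Fin n) := by
      rw [← lintegral_const_mul' _ _ (by finiteness)]
      refine lintegral_congr_ae ?_
      filter_upwards [ae_injective Λ hd (Fin n)] with x hx
      by_cases hX : toConfig n x ∈ dissociating Λ δ
      · rw [Set.indicator_of_mem hX, Set.indicator_of_mem hX, weight_toConfig Λ hq0 hz hx,
          toConfig_points]
      · rw [Set.indicator_of_notMem hX, Set.indicator_of_notMem hX, mul_zero]
    rw [hn, lintegral_weight_toConfig Λ hd hq0 hz]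
    have := lintegral_dissociating_le Λ hd (Q := ENNReal.ofReal q)
      (by simpa using ENNReal.ofReal_le_ofReal hq) (by finiteness) δ hδ n
    calc _ = (Nat.factorial n : ENNReal)⁻¹ * ENNReal.ofReal z ^ n * (δ *
          ∫⁻ x, (dissociating Λ δ).indicator
            (fun X => ENNReal.ofReal q ^ numClusters Λ X.points) (toConfig n x)
            ∂tupleMeasure Λ (Fin n)) := by ring
      _ ≤ (Nat.factorial n : ENNReal)⁻¹ * ENNReal.ofReal z ^ n * (K *
          ∫⁻ x, ENNReal.ofReal q ^ numClusters Λ (tupleSet x) ∂tupleMeasure Λ (Fin n)) := by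
        gcongr
      _ = _ := by ring
  rw [randomCluster, Measure.smul_apply, withDensity_apply _ hA, smul_eq_mul]
  calc _ = (partitionFunction Λ q z)⁻¹ *
        (δ * ∫⁻ X in dissociating Λ δ, weight Λ q z X ∂lebesguePoisson Λ) := by ring
    _ ≤ (partitionFunction Λ q z)⁻¹ * (K * partitionFunction Λ q z) := by gcongr
    _ = K * ((partitionFunction Λ q z)⁻¹ * partitionFunction Λ q z) := by ring
    _ = K := by
      rw [ENNReal.inv_mul_cancel (partitionFunction_ne_zero Λ q z)
        (partitionFunction_ne_top Λ hd hq0 hz), mul_one]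

end ContinuumPotts

end

open ContinuumPotts in
/-- The first conjunct says that the maximum defining `κ(Λ)` is attained; that the
random-cluster measure is a probability measure is stated together with the bound. -/
theorem mainTheorem1 {d : ℕ} (hd : 2 ≤ d) (Λ : BoxIntegral.Box (Fin d)) :
    IsGreatest {k | ∃ X : Finset (Point d), (X : Set (Point d)) ⊆ region Λ ∧
        numClusters Λ X = k}
      (maxClusters Λ) ∧
    ∀ q : ℝ, 0 < q → ∀ δ : ℝ, 0 < δ → ∀ z : ℝ, 0 < z →
      MeasureTheory.IsProbabilityMeasure (randomCluster Λ q z) ∧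
      (randomCluster Λ q z).real
          {X : Config d | (X.points : Set (Point d)) ⊆ region Λ ∧
            ∃ C : Finset (Point d), IsCluster Λ X.points C ∧
              δ ≤ dissociationProb Λ X.points C}
        ≤ 2 ^ maxClusters Λ / (δ * q) := by
  have hd0 : 0 < d := two_pos.trans_le hd
  refine ⟨isGreatest_maxClusters Λ, fun q hq δ hδ z hz => ?_⟩
  have hprob := isProbabilityMeasure_randomCluster Λ hd0 hq hz
  refine ⟨hprob, ?_⟩
  rcases le_or_gt 1 q with hq1 | hq1
  · refine (measureReal_mono (s₂ := dissociating Λ (ENNReal.ofReal δ)) ?_).trans ?_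
    · rintro X ⟨hX, C, hC, hδC⟩
      exact mem_dissociating Λ hX hC hδC
    · have h := mul_randomCluster_dissociating_le Λ hd0 hq1 hz (ENNReal.ofReal_ne_top (r := δ))
      have hfin : (ENNReal.ofReal q)⁻¹ * 2 ^ maxClusters Λ ≠ ⊤ :=
        ENNReal.mul_ne_top (ENNReal.inv_ne_top.2 (by simpa using hq)) (by finiteness)
      have h' := ENNReal.toReal_mono hfin h
      rw [ENNReal.toReal_mul, ENNReal.toReal_mul, ENNReal.toReal_inv, ENNReal.toReal_pow,
        ENNReal.toReal_ofReal hδ.le, ENNReal.toReal_ofReal hq.le, ENNReal.toReal_ofNat] at h'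
      rw [le_div_iff₀ (by positivity), Measure.real]
      calc _ = (δ * (randomCluster Λ q z (dissociating Λ (ENNReal.ofReal δ))).toReal) * q := by
            ring
        _ ≤ (q⁻¹ * 2 ^ maxClusters Λ) * q := by gcongr
        _ = 2 ^ maxClusters Λ := by field_simp
  -- For `q < 1` the bound is at least `1` when `δ ≤ 1`, and the event is empty when `δ > 1`.
  · rcases le_or_gt δ 1 with hδ1 | hδ1
    · refine measureReal_le_one.trans ?_
      rw [le_div_iff₀ (by positivity), one_mul]
      exact (mul_le_one₀ hδ1 hq.le hq1.le).trans (one_le_pow₀ one_le_two)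
    · rw [Set.eq_empty_of_forall_notMem (s := {X : Config d | _})]
      · rw [measureReal_empty]
        positivity
      · rintro X ⟨-, C, -, hC⟩
        exact absurd (hC.trans (dissociationProb_le_one Λ _ C)) (not_le.2 hδ1)
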